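/- Let $n\ge 0$ be an integer. There exist constants $C>0$ and $m\in\mathbb N$, depending only on $n$, such that the following holds for every bounded open set $\Omega\subset\mathbb R^{n+1}$. Let $$Lu=\sum_{i,j}a_{ij}D_iD_ju+\sum_i b^iD_iu+cu$$ have measurable coefficients on $\Omega$ with, for constants $\lambda,\Lambda,c_1,c_2>0$ and almost everywhere in $\Omega$, $$\lambda|\xi|^2\le \sum_{i,j}a_{ij}\xi_i\xi_j\le\Lambda|\xi|^2\ \text{ for all }\xi\in\mathbb R^{n+1},\qquad |b^i|\le c_1\ \text{ for all } i,\qquad |c|\le c_2,\qquad c\le 0 .$$ Let $f\in L^{n+1}(\Omega)$ and let $u\in C^0(\bar\Omega)\cap W^{2,n+1}_{\mathrm{loc}}(\Omega)$ vanish on $\partial\Omega$ and satisfy $Lu\ge f$ almost everywhere in $\Omega$. Then $$\sup_\Omega u\le e^{P}\,(\operatorname{diam}\Omega)\,\|f\|_{L^{n+1}(\Omega)},\qquad P=C\,(1+|\Omega|)\,\Bigl(\max\bigl\{\lambda,\tfrac1\lambda,\Lambda,\tfrac1\Lambda,c_1,\tfrac1{c_1},c_2,\tfrac1{c_2}\bigr\}\Bigr)^{m},$$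 where $|\Omega|$ is the Lebesgue measure of $\Omega$. In particular, on a fixed $\Omega$ (or for all $\Omega$ of measure at most a given constant) the constant is $e^{P}$ with $P=P(\lambda,\Lambda,c_1,c_2)$ depending at most polynomially on $\lambda^{\pm1},\Lambda^{\pm1},c_1^{\pm1},c_2^{\pm1}$. -/

import Mathlib

open MeasureTheory
open scoped ENNReal ContDiff

noncomputable section

namespace ABP

/-- Local `L^p` membership: `g ∈ L^p(K)` for every compact `K ⊆ Ω`. -/
def MemLpLoc {N : ℕ} (p : ℝ≥0∞) (Ω : Set (EuclideanSpace ℝ (Fin N)))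
    (g : EuclideanSpace ℝ (Fin N) → ℝ) : Prop :=
  ∀ K : Set (EuclideanSpace ℝ (Fin N)), IsCompact K → K ⊆ Ω →
    MemLp g p (volume.restrict K)

/-- `v` is the weak partial derivative `D_i u` on the open set `Ω`. -/
structure HasWeakPartial {N : ℕ} (Ω : Set (EuclideanSpace ℝ (Fin N))) (i : Fin N)
    (u v : EuclideanSpace ℝ (Fin N) → ℝ) : Prop where
  locallyIntegrable : LocallyIntegrableOn u Ω volume
  locallyIntegrable_deriv : LocallyIntegrableOn v Ω volume
  integral_eq : ∀ φ : EuclideanSpace ℝ (Fin N) → ℝ,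
    ContDiff ℝ ∞ φ → HasCompactSupport φ → tsupport φ ⊆ Ω →
      ∫ x in Ω, u x * fderiv ℝ φ x (EuclideanSpace.single i 1) = - ∫ x in Ω, v x * φ x

/-- `u ∈ W^{2,p}_loc(Ω)`, with weak gradient `Du` and weak Hessian `D2u`
(`D2u i j` is the weak partial derivative of `Du j` in direction `i`). -/
structure IsW2Loc {N : ℕ} (p : ℝ≥0∞) (Ω : Set (EuclideanSpace ℝ (Fin N)))
    (u : EuclideanSpace ℝ (Fin N) → ℝ)
    (Du : Fin N → EuclideanSpace ℝ (Fin N) → ℝ)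
    (D2u : Fin N → Fin N → EuclideanSpace ℝ (Fin N) → ℝ) : Prop where
  memLp : MemLpLoc p Ω u
  memLp_grad : ∀ i, MemLpLoc p Ω (Du i)
  memLp_hess : ∀ i j, MemLpLoc p Ω (D2u i j)
  weak_grad : ∀ i, HasWeakPartial Ω i u (Du i)
  weak_hess : ∀ i j, HasWeakPartial Ω i (Du j) (D2u i j)

/-- `u ∈ C⁰₀(Ω̄)`: continuous on the closure and zero on the boundary. -/
structure IsC00 {N : ℕ} (Ω : Set (EuclideanSpace ℝ (Fin N)))
    (u : EuclideanSpace ℝ (Fin N) → ℝ) : Prop where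
  continuousOn : ContinuousOn u (closure Ω)
  eq_zero : ∀ x ∈ frontier Ω, u x = 0

/-- The assumptions on the coefficients of `L = a_ij D_i D_j + b^i D_i + c` on `Ω`:
measurability and `lam ≤ a ≤ Lam` (as quadratic forms), `|b^i| ≤ c₁`, `|c| ≤ c₂`, `c ≤ 0`. -/
structure CoeffBounds {N : ℕ} (Ω : Set (EuclideanSpace ℝ (Fin N)))
    (a : Fin N → Fin N → EuclideanSpace ℝ (Fin N) → ℝ)
    (b : Fin N → EuclideanSpace ℝ (Fin N) → ℝ)
    (c : EuclideanSpace ℝ (Fin N) → ℝ) (lam Lam c₁ c₂ : ℝ) : Prop where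
  measurable_a : ∀ i j, AEMeasurable (a i j) (volume.restrict Ω)
  measurable_b : ∀ i, AEMeasurable (b i) (volume.restrict Ω)
  measurable_c : AEMeasurable c (volume.restrict Ω)
  lower : ∀ᵐ x ∂(volume.restrict Ω), ∀ ξ : EuclideanSpace ℝ (Fin N),
    lam * ‖ξ‖ ^ 2 ≤ ∑ i, ∑ j, a i j x * ξ i * ξ j
  upper : ∀ᵐ x ∂(volume.restrict Ω), ∀ ξ : EuclideanSpace ℝ (Fin N),
    ∑ i, ∑ j, a i j x * ξ i * ξ j ≤ Lam * ‖ξ‖ ^ 2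
  bound_b : ∀ᵐ x ∂(volume.restrict Ω), ∀ i, |b i x| ≤ c₁
  bound_c : ∀ᵐ x ∂(volume.restrict Ω), |c x| ≤ c₂
  nonpos_c : ∀ᵐ x ∂(volume.restrict Ω), c x ≤ 0

/-- `Lu = a_ij D_i D_j u + b^i D_i u + c u`, for `u` with derivatives `Du` and `D2u`. -/
def ellipticOp {N : ℕ}
    (a : Fin N → Fin N → EuclideanSpace ℝ (Fin N) → ℝ)
    (b : Fin N → EuclideanSpace ℝ (Fin N) → ℝ)
    (c : EuclideanSpace ℝ (Fin N) → ℝ)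
    (u : EuclideanSpace ℝ (Fin N) → ℝ)
    (Du : Fin N → EuclideanSpace ℝ (Fin N) → ℝ)
    (D2u : Fin N → Fin N → EuclideanSpace ℝ (Fin N) → ℝ)
    (x : EuclideanSpace ℝ (Fin N)) : ℝ :=
  (∑ i, ∑ j, a i j x * D2u i j x) + (∑ i, b i x * Du i x) + c x * u x

/-- The largest of the numbers `l, 1 / l` for `l ∈ {lam, Lam, c₁, c₂}`. -/
def coeffSize (lam Lam c₁ c₂ : ℝ) : ℝ :=
  max (max (max lam lam⁻¹) (max Lam Lam⁻¹)) (max (max c₁ c₁⁻¹) (max c₂ c₂⁻¹))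

end ABP

end

namespace ABP

/-! Write N = n + 1. For a C² function w, nonpositive off the interior of a compact set of diameter
at most d, put M = w(x₀)/d. Every p with |p| < M is the gradient of w at an interior point where w >
0 and D²w ≤ 0: maximize w(x) - p·x (`exists_contact_point`). So the gradient map sends the set Γ of
such points onto the ball of radius M.

Integrate the weight (μ + |p|)^(-N) over this ball. From below the integral is at least a multiple
of log(M/μ) (`ofReal_log_le_lintegral_ball`). From above, change of variables bounds it by the
integral over Γ of |det D²w| (μ + |Dw|)^(-N). There det(-D²w) ≤ tr(-D²w)^N, and ellipticity with the
differential inequality bounds the trace by λ⁻¹(h + β|Dw|); the weight reduces this to λ⁻¹(h/μ + β).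
If μ dominates the L^N norm of h, then log(M/μ) is at most a constant times λ^(-N)(1 + β^N|Ω|).
Exponentiating gives `le_of_contDiff`, with a polynomial exponent.

A general u is mollified on a compact part of Ω containing {u ≥ ε}. The second derivatives converge
only in L^N, but the error merely enters h and makes its norm slightly exceed that of f. The bounds
Λ and c₂ serve only to control this error, so the exponent involves just λ⁻¹, c₁ and |Ω|. -/

theorem det_le_trace_pow {N : ℕ} {B : Matrix (Fin N) (Fin N) ℝ} (hB : B.PosSemidef) :
    B.det ≤ B.trace ^ N := by
  have hd := hB.isHermitian.det_eq_prod_eigenvalues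
  have ht := hB.isHermitian.trace_eq_sum_eigenvalues
  simp only [RCLike.ofReal_real_eq_id, id] at hd ht
  rw [hd, ht]
  calc ∏ i, hB.isHermitian.eigenvalues i
      ≤ ∏ _i : Fin N, ∑ j, hB.isHermitian.eigenvalues j :=
        Finset.prod_le_prod (fun i _ => hB.eigenvalues_nonneg i) fun i _ =>
          Finset.single_le_sum (f := hB.isHermitian.eigenvalues)
            (fun j _ => hB.eigenvalues_nonneg j) (Finset.mem_univ i)
    _ = _ := by simp

/-- A positive semidefinite matrix is a sum of rank-one matrices v vᵀ; ellipticity is applied to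
each v. No symmetry of `a` is needed. -/
theorem mul_trace_le_sum_mul {N : ℕ} {B : Matrix (Fin N) (Fin N) ℝ} (hB : B.PosSemidef)
    {a : Fin N → Fin N → ℝ} {lam : ℝ}
    (ha : ∀ ξ : EuclideanSpace ℝ (Fin N), lam * ‖ξ‖ ^ 2 ≤ ∑ i, ∑ j, a i j * ξ i * ξ j) :
    lam * B.trace ≤ ∑ i, ∑ j, a i j * B i j := by
  obtain ⟨m, v, rfl⟩ := Matrix.posSemidef_iff_eq_sum_vecMulVec.mp hB
  have h1 : ∀ k, lam * ∑ i, v k i * v k i ≤ ∑ i, ∑ j, a i j * (v k i * v k j) := fun k => by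
    have h := ha (WithLp.toLp 2 (v k))
    rw [EuclideanSpace.norm_sq_eq] at h
    simpa [pow_two, mul_assoc] using h
  calc lam * (∑ k, Matrix.vecMulVec (v k) (star (v k))).trace
      = ∑ k, lam * ∑ i, v k i * v k i := by
        simp only [Matrix.trace_sum, Finset.mul_sum]
        simp [Matrix.trace, Matrix.vecMulVec_apply, Finset.mul_sum]
    _ ≤ ∑ k, ∑ i, ∑ j, a i j * (v k i * v k j) := Finset.sum_le_sum fun k _ => h1 k
    _ = _ := by
        rw [Finset.sum_comm]
        refine Finset.sum_congr rfl fun i _ => ?_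
        rw [Finset.sum_comm]
        refine Finset.sum_congr rfl fun j _ => ?_
        simp [Matrix.sum_apply, Matrix.vecMulVec_apply, Finset.mul_sum]

/-! ### Gradient, Hessian and contact points. -/

/-- The gradient of `w` in coordinates. -/
noncomputable def grad {N : ℕ} (w : EuclideanSpace ℝ (Fin N) → ℝ) (x : EuclideanSpace ℝ (Fin N)) :
    EuclideanSpace ℝ (Fin N) :=
  WithLp.toLp 2 fun j => fderiv ℝ w x (EuclideanSpace.single j 1)

/-- The Hessian of `w` in coordinates. -/
noncomputable def hess {N : ℕ} (w : EuclideanSpace ℝ (Fin N) → ℝ) (x : EuclideanSpace ℝ (Fin N)) :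
    Matrix (Fin N) (Fin N) ℝ :=
  Matrix.of fun i j =>
    fderiv ℝ (fun y => fderiv ℝ w y (EuclideanSpace.single j 1)) x (EuclideanSpace.single i 1)

section Hessian

variable {N : ℕ} {w : EuclideanSpace ℝ (Fin N) → ℝ}

theorem hess_apply (hw : ContDiff ℝ 2 w) (x : EuclideanSpace ℝ (Fin N)) (i j : Fin N) :
    hess w x i j = fderiv ℝ (fderiv ℝ w) x (EuclideanSpace.single i 1)
      (EuclideanSpace.single j 1) := by
  have hd : DifferentiableAt ℝ (fderiv ℝ w) x :=
    (hw.fderiv_right (m := 1) (by norm_num)).differentiable (by norm_num) x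
  simp only [hess, Matrix.of_apply]
  rw [fderiv_clm_apply hd (differentiableAt_const _)]
  simp

theorem hess_symm (hw : ContDiff ℝ 2 w) (x : EuclideanSpace ℝ (Fin N)) (i j : Fin N) :
    hess w x i j = hess w x j i := by
  rw [hess_apply hw, hess_apply hw]
  exact (hw.contDiffAt.isSymmSndFDerivAt (by simp)) _ _

theorem eq_sum_single (ξ : EuclideanSpace ℝ (Fin N)) :
    ξ = ∑ i, ξ i • EuclideanSpace.single i (1 : ℝ) := by
  ext k
  simp [Pi.single_apply]

theorem sum_hess_mul (hw : ContDiff ℝ 2 w) (x ξ : EuclideanSpace ℝ (Fin N)) :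
    ∑ i, ∑ j, hess w x i j * ξ i * ξ j = fderiv ℝ (fderiv ℝ w) x ξ ξ := by
  conv_rhs => rw [eq_sum_single ξ]
  simp only [map_sum, map_smul, _root_.sum_apply, _root_.smul_apply,
    smul_eq_mul, Finset.mul_sum, hess_apply hw]
  rw [Finset.sum_comm]
  exact Finset.sum_congr rfl fun i _ => Finset.sum_congr rfl fun j _ => by ring

theorem contDiff_grad (hw : ContDiff ℝ 2 w) : ContDiff ℝ 1 (grad w) := by
  rw [contDiff_euclidean]
  intro j
  exact (hw.fderiv_right (m := 1) (by norm_num)).clm_apply contDiff_const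

theorem fderiv_grad_apply (hw : ContDiff ℝ 2 w) (x v : EuclideanSpace ℝ (Fin N)) (j : Fin N) :
    fderiv ℝ (grad w) x v j
      = fderiv ℝ (fun y => fderiv ℝ w y (EuclideanSpace.single j 1)) x v := by
  have hd : DifferentiableAt ℝ (grad w) x := (contDiff_grad hw).differentiable (by norm_num) x
  have h := ((EuclideanSpace.proj (𝕜 := ℝ) j).hasFDerivAt.comp x hd.hasFDerivAt).fderiv
  have h2 : (EuclideanSpace.proj (𝕜 := ℝ) j : EuclideanSpace ℝ (Fin N) →L[ℝ] ℝ) ∘ grad w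
    = fun y => fderiv ℝ w y (EuclideanSpace.single j 1) := rfl
  rw [h2] at h
  rw [h]
  rfl

theorem det_fderiv_grad (hw : ContDiff ℝ 2 w) (x : EuclideanSpace ℝ (Fin N)) :
    (fderiv ℝ (grad w) x).det = (hess w x).det := by
  -- The row index of `hess` is the direction of differentiation, so `hess` is the transpose of the
  -- Jacobian matrix of `grad w`.
  rw [ContinuousLinearMap.det,
    ← LinearMap.det_toMatrix (EuclideanSpace.basisFun (Fin N) ℝ).toBasis, ← Matrix.det_transpose]
  congr 1
  ext i j
  simp [LinearMap.toMatrix_apply, fderiv_grad_apply hw, hess]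

/-- The second order necessary condition at a local maximum, up to an affine function. -/
theorem fderiv_fderiv_nonpos_of_isLocalMax_sub {E : Type*} [NormedAddCommGroup E]
    [NormedSpace ℝ E] {w : E → ℝ} (hw : ContDiff ℝ 2 w) {y : E}
    {ℓ : E →L[ℝ] ℝ} (hy : IsLocalMax (fun x => w x - ℓ x) y) (ξ : E) :
    fderiv ℝ (fderiv ℝ w) y ξ ξ ≤ 0 := by
  by_contra! hpos
  set γ : ℝ → E := fun t => y + t • ξ with hγ
  have hγd : ∀ t, HasDerivAt γ ξ t := fun t => by
    simpa only [one_smul, id] using ((hasDerivAt_id t).smul_const ξ).const_add y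
  have hγ0 : γ 0 = y := by simp [hγ]
  set φ : ℝ → ℝ := fun t => w (γ t) - ℓ (γ t) with hφ
  have hd1 : ∀ t, HasDerivAt φ (fderiv ℝ w (γ t) ξ - ℓ ξ) t := fun t =>
    (((hw.differentiable (by norm_num) _).hasFDerivAt.comp_hasDerivAt t (hγd t))).sub
      (ℓ.hasFDerivAt.comp_hasDerivAt t (hγd t))
  have hd1' : deriv φ = fun t => fderiv ℝ w (γ t) ξ - ℓ ξ := funext fun t => (hd1 t).deriv
  have hfd : DifferentiableAt ℝ (fderiv ℝ w) (γ 0) :=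
    (hw.fderiv_right (m := 1) (by norm_num)).differentiable (by norm_num) _
  have hd2 : HasDerivAt (deriv φ) (fderiv ℝ (fderiv ℝ w) y ξ ξ) 0 := by
    rw [hd1']
    have h := (hfd.hasFDerivAt.comp_hasDerivAt 0 (hγd 0)).clm_apply (hasDerivAt_const 0 ξ)
    simpa [hγ0] using h.sub_const (ℓ ξ)
  have hcont : ContinuousAt φ 0 := (hd1 0).continuousAt
  have hmax : IsLocalMax φ 0 := by
    have : Filter.Tendsto γ (nhds 0) (nhds y) := by
      simpa [hγ0] using (hγd 0).continuousAt.tendsto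
    have h := this.eventually hy
    simpa [IsLocalMax, IsMaxFilter, hφ, hγ0] using h
  -- A positive second derivative makes 0 a local minimum too, so `φ` is locally constant,
  -- contradicting that positivity.
  have hmin : IsLocalMin φ 0 :=
    isLocalMin_of_deriv_deriv_pos (by rw [hd2.deriv]; exact hpos) hmax.deriv_eq_zero hcont
  have hconst : φ =ᶠ[nhds 0] fun _ => φ 0 := by
    filter_upwards [hmax, hmin] with t h1 h2 using le_antisymm h1 h2
  have h3 : deriv (deriv φ) 0 = 0 := by
    rw [hconst.deriv.deriv_eq]
    simp
  rw [hd2.deriv] at h3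
  exact hpos.ne' h3

theorem posSemidef_neg_hess (hw : ContDiff ℝ 2 w) {y : EuclideanSpace ℝ (Fin N)}
    (h : ∀ ξ, fderiv ℝ (fderiv ℝ w) y ξ ξ ≤ 0) : (-hess w y).PosSemidef := by
  refine Matrix.PosSemidef.of_dotProduct_mulVec_nonneg ?_ fun ξ => ?_
  · ext i j
    simp [hess_symm hw y i j]
  · have h1 := h (WithLp.toLp 2 ξ)
    rw [← sum_hess_mul hw] at h1
    have h2 : star ξ ⬝ᵥ (-hess w y).mulVec ξ = - ∑ i, ∑ j, hess w y i j * ξ i * ξ j := by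
      simp only [dotProduct, Matrix.mulVec, Finset.mul_sum, ← Finset.sum_neg_distrib]
      refine Finset.sum_congr rfl fun i _ => Finset.sum_congr rfl fun j _ => ?_
      simp
      ring
    rw [h2]
    simpa using h1

/-- Each vector of length less than `w x₀ / d` is the gradient of `w` at an interior point at which
`w` is positive and its Hessian is nonpositive. -/
theorem exists_contact_point (hw : ContDiff ℝ 2 w) {Q : Set (EuclideanSpace ℝ (Fin N))}
    (hQ : IsCompact Q) (hbd : ∀ x ∈ Q, x ∉ interior Q → w x ≤ 0) {d : ℝ} (hd : 0 < d)
    (hQd : ∀ x ∈ Q, ∀ y ∈ Q, dist x y ≤ d) {x₀ : EuclideanSpace ℝ (Fin N)} (hx₀ : x₀ ∈ Q)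
    {p : EuclideanSpace ℝ (Fin N)} (hp : ‖p‖ < w x₀ / d) :
    ∃ y ∈ interior Q, 0 < w y ∧ grad w y = p ∧ ∀ ξ, fderiv ℝ (fderiv ℝ w) y ξ ξ ≤ 0 := by
  have hcont : Continuous fun x => w x - innerSL ℝ p x :=
    hw.continuous.sub (innerSL ℝ p).continuous
  obtain ⟨y, hyQ, hy⟩ := hQ.exists_isMaxOn ⟨x₀, hx₀⟩ hcont.continuousOn
  -- Comparison with `x₀` gives w(y) ≥ w(x₀) - |p| d > 0, which keeps the maximum point off the
  -- boundary.
  have h1 : w x₀ - inner ℝ p x₀ ≤ w y - inner ℝ p y := hy hx₀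
  have h2 : inner ℝ p (x₀ - y) ≤ ‖p‖ * d :=
    (real_inner_le_norm _ _).trans
      (mul_le_mul_of_nonneg_left (by simpa [dist_eq_norm] using hQd x₀ hx₀ y hyQ) (norm_nonneg _))
  have h3 : ‖p‖ * d < w x₀ := (lt_div_iff₀ hd).mp hp
  rw [inner_sub_right] at h2
  have hwy : 0 < w y := by linarith
  have hyi : y ∈ interior Q := by
    by_contra hn
    exact absurd (hbd y hyQ hn) (not_le.mpr hwy)
  have hloc : IsLocalMax (fun x => w x - innerSL ℝ p x) y :=
    hy.isLocalMax (mem_interior_iff_mem_nhds.mp hyi)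
  refine ⟨y, hyi, hwy, ?_, fderiv_fderiv_nonpos_of_isLocalMax_sub hw hloc⟩
  have hfd := hloc.fderiv_eq_zero
  rw [fderiv_fun_sub (hw.differentiable (by norm_num) y) (innerSL ℝ p).differentiableAt,
    ContinuousLinearMap.fderiv, sub_eq_zero] at hfd
  ext j
  simp [grad, hfd, EuclideanSpace.inner_single_right]

end Hessian

/-! ### Change of variables and the logarithmic weight. -/

/-- The area inequality for images says that the measure on `T` is dominated by the pushforward of
|det F'| μ on `s`. Multiplicity only helps, so `F` need not be injective. -/
theorem setLIntegral_le_lintegral_abs_det_fderiv_mul {E : Type*} [NormedAddCommGroup E]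
    [NormedSpace ℝ E] [FiniteDimensional ℝ E] [MeasurableSpace E] [BorelSpace E] (μ : Measure E)
    [μ.IsAddHaarMeasure] {F : E → E} {F' : E → E →L[ℝ] E} {s T : Set E} (hs : MeasurableSet s)
    (hF' : ∀ x ∈ s, HasFDerivWithinAt F (F' x) s x) (hF : Measurable F) (hT : T ⊆ F '' s)
    {g : E → ℝ≥0∞} (hg : Measurable g) :
    ∫⁻ y in T, g y ∂μ ≤ ∫⁻ x in s, ENNReal.ofReal |(F' x).det| * g (F x) ∂μ := by
  set D : E → ℝ≥0∞ := fun x => ENNReal.ofReal |(F' x).det|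
  have hD : AEMeasurable D (μ.restrict s) := aemeasurable_ofReal_abs_det_fderivWithin μ hs hF'
  have hle : μ.restrict T ≤ ((μ.restrict s).withDensity D).map F := by
    refine Measure.le_iff.mpr fun A hA => ?_
    rw [Measure.restrict_apply hA, Measure.map_apply hF hA, withDensity_apply _ (hF hA),
      Measure.restrict_restrict (hF hA), Set.inter_comm (F ⁻¹' A)]
    refine (measure_mono ?_).trans (addHaar_image_le_lintegral_abs_det_fderiv μ
      (hs.inter (hF hA)) fun x hx => (hF' x hx.1).mono Set.inter_subset_left)
    rintro y ⟨hyA, hyT⟩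
    obtain ⟨x, hx, rfl⟩ := hT hyT
    exact ⟨x, ⟨hx, hyA⟩, rfl⟩
  calc ∫⁻ y in T, g y ∂μ ≤ ∫⁻ y, g y ∂((μ.restrict s).withDensity D).map F :=
        lintegral_mono' hle le_rfl
    _ = _ := by
        rw [lintegral_map hg hF,
          lintegral_withDensity_eq_lintegral_mul₀ hD (g := fun x => g (F x))
            (hg.comp hF).aemeasurable]
        rfl

/-- For r > μ one has (μ + r)⁻¹ ≥ (2r)⁻¹, and in polar coordinates r^(N-1)(2r)^(-N) = 2^(-N)/r
integrates to the logarithm over (μ, M). -/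
theorem ofReal_log_le_lintegral_ball {E : Type*} [NormedAddCommGroup E]
    [NormedSpace ℝ E] [FiniteDimensional ℝ E] [Nontrivial E] [MeasurableSpace E] [BorelSpace E]
    (ν : Measure E) [ν.IsAddHaarMeasure] {μ M : ℝ} (hμ : 0 < μ) (hM : μ ≤ M) :
    ENNReal.ofReal (Module.finrank ℝ E * ν.real (Metric.ball 0 1) * (2⁻¹ ^ Module.finrank ℝ E
        * Real.log (M / μ)))
      ≤ ∫⁻ p in Metric.ball (0 : E) M,
        ENNReal.ofReal ((μ + ‖p‖)⁻¹ ^ Module.finrank ℝ E) ∂ν := by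
  set N := Module.finrank ℝ E
  have hN : 0 < N := Module.finrank_pos
  set f : ℝ → ℝ := (Set.Ioo μ M).indicator fun r => (2 * r)⁻¹ ^ N with hf
  have hfm : Measurable f :=
    (by fun_prop : Measurable fun r : ℝ => (2 * r)⁻¹ ^ N).indicator measurableSet_Ioo
  have hf0 : ∀ r, 0 ≤ f r := fun r => by
    by_cases hr : r ∈ Set.Ioo μ M
    · have : 0 < r := hμ.trans hr.1
      rw [hf, Set.indicator_of_mem hr]
      positivity
    · rw [hf, Set.indicator_of_notMem hr]
  have hrad : ∫ y in Set.Ioi (0 : ℝ), y ^ (N - 1) • f y = 2⁻¹ ^ N * Real.log (M / μ) := by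
    have h1 : ∀ y ∈ Set.Ioi (0 : ℝ), y ^ (N - 1) • f y
        = (Set.Ioo μ M).indicator (fun r => 2⁻¹ ^ N * r⁻¹) y := fun y hy => by
      have hy' : y ≠ 0 := (Set.mem_Ioi.mp hy).ne'
      by_cases hr : y ∈ Set.Ioo μ M
      · rw [hf, Set.indicator_of_mem hr, Set.indicator_of_mem hr, mul_inv, mul_pow, smul_eq_mul]
        obtain ⟨k, hk⟩ : ∃ k, N = k + 1 := ⟨N - 1, by omega⟩
        rw [hk, Nat.add_sub_cancel, pow_succ y⁻¹]
        have : y ^ k * y⁻¹ ^ k = 1 := by rw [← mul_pow, mul_inv_cancel₀ hy', one_pow]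
        linear_combination (2⁻¹ ^ (k + 1) * y⁻¹) * this
      · rw [hf, Set.indicator_of_notMem hr, Set.indicator_of_notMem hr, smul_zero]
    rw [setIntegral_congr_fun measurableSet_Ioi h1, setIntegral_indicator measurableSet_Ioo,
      Set.inter_eq_right.mpr (Set.Ioo_subset_Ioi_self.trans (Set.Ioi_subset_Ioi hμ.le)),
      ← integral_Ioc_eq_integral_Ioo,
      ← intervalIntegral.integral_of_le hM, intervalIntegral.integral_const_mul,
      integral_inv_of_pos hμ (hμ.trans_le hM)]
  have hint := integral_fun_norm_addHaar ν f
  rw [hrad, nsmul_eq_mul, smul_eq_mul, ← mul_assoc] at hint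
  rw [← hint, integral_eq_lintegral_of_nonneg_ae (.of_forall fun x => hf0 _)
    (hfm.comp measurable_norm).aestronglyMeasurable]
  refine ENNReal.ofReal_toReal_le.trans ?_
  rw [← lintegral_indicator Metric.isOpen_ball.measurableSet]
  refine lintegral_mono fun x => ?_
  by_cases hr : ‖x‖ ∈ Set.Ioo μ M
  · rw [Set.indicator_of_mem (by simpa using hr.2), hf, Set.indicator_of_mem hr]
    have hr1 := hr.1
    gcongr
    linarith
  · rw [hf, Set.indicator_of_notMem hr]
    simp

/-! ### The estimate for C² functions. -/

theorem abs_det_le {N : ℕ} {H : Matrix (Fin N) (Fin N) ℝ} (hH : (-H).PosSemidef)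
    {a : Fin N → Fin N → ℝ} {lam κ : ℝ} (hlam : 0 < lam)
    (ha : ∀ ξ : EuclideanSpace ℝ (Fin N), lam * ‖ξ‖ ^ 2 ≤ ∑ i, ∑ j, a i j * ξ i * ξ j)
    (hκ : -κ ≤ ∑ i, ∑ j, a i j * H i j) : |H.det| ≤ (lam⁻¹ * κ) ^ N := by
  have h1 : |H.det| = (-H).det := by
    rw [← abs_of_nonneg hH.det_nonneg, Matrix.det_neg, abs_mul, abs_pow]
    simp
  have h2 := mul_trace_le_sum_mul hH ha
  have h3 : ∑ i, ∑ j, a i j * (-H) i j = -∑ i, ∑ j, a i j * H i j := by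
    simp [Finset.sum_neg_distrib]
  rw [h1]
  refine (det_le_trace_pow hH).trans (pow_le_pow_left₀ hH.trace_nonneg ?_ N)
  rw [← div_eq_inv_mul, le_div_iff₀ hlam]
  linarith

/-- The Aleksandrov–Bakelman–Pucci estimate for `C²` functions. -/
theorem le_of_contDiff {N : ℕ} [NeZero N] {w : EuclideanSpace ℝ (Fin N) → ℝ} (hw : ContDiff ℝ 2 w)
    {Q : Set (EuclideanSpace ℝ (Fin N))} (hQ : IsCompact Q)
    (hbd : ∀ x ∈ Q, x ∉ interior Q → w x ≤ 0) {d : ℝ} (hd : 0 < d)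
    (hQd : ∀ x ∈ Q, ∀ y ∈ Q, dist x y ≤ d)
    {a : Fin N → Fin N → EuclideanSpace ℝ (Fin N) → ℝ} {lam β μ : ℝ}
    (hlam : 0 < lam) (hβ : 0 ≤ β) (hμ : 0 < μ)
    (ha : ∀ᵐ x ∂(volume.restrict Q), ∀ ξ : EuclideanSpace ℝ (Fin N),
      lam * ‖ξ‖ ^ 2 ≤ ∑ i, ∑ j, a i j x * ξ i * ξ j)
    {h : EuclideanSpace ℝ (Fin N) → ℝ} (hh : ∀ x, 0 ≤ h x)
    (hL : ∀ᵐ x ∂(volume.restrict Q), 0 < w x →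
      -(h x + β * ‖grad w x‖) ≤ ∑ i, ∑ j, a i j x * hess w x i j)
    (hhμ : ∫⁻ x in Q, ENNReal.ofReal (h x) ^ N ≤ ENNReal.ofReal μ ^ N)
    {x₀ : EuclideanSpace ℝ (Fin N)} (hx₀ : x₀ ∈ Q) :
    w x₀ ≤ d * μ * Real.exp (4 ^ N / (N *
      volume.real (Metric.ball (0 : EuclideanSpace ℝ (Fin N)) 1))
        * (lam⁻¹ ^ N * (1 + β ^ N * volume.real Q))) := by
  have hN : 0 < N := NeZero.pos N
  have : Nontrivial (EuclideanSpace ℝ (Fin N)) :=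
    Module.nontrivial_of_finrank_pos (R := ℝ) (by simpa using hN)
  set vB := volume.real (Metric.ball (0 : EuclideanSpace ℝ (Fin N)) 1)
  have hvB : 0 < vB := ENNReal.toReal_pos (Metric.measure_ball_pos _ _ one_pos).ne'
    measure_ball_lt_top.ne
  set M := w x₀ / d with hM
  have hwM : w x₀ = d * M := by rw [hM]; field_simp
  set X := lam⁻¹ ^ N * (1 + β ^ N * volume.real Q) with hX
  have hX0 : 0 ≤ X := by positivity
  rw [hwM, mul_assoc]
  refine mul_le_mul_of_nonneg_left ?_ hd.le
  -- If M ≤ μ the claim is trivial, the exponential being at least 1.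
  rcases le_or_gt M μ with hMμ | hMμ
  · exact hMμ.trans (le_mul_of_one_le_right hμ.le (Real.one_le_exp (by positivity)))
  set Γ : Set (EuclideanSpace ℝ (Fin N)) :=
    Q ∩ ({x | 0 < w x} ∩ {x | ∀ ξ, fderiv ℝ (fderiv ℝ w) x ξ ξ ≤ 0}) with hΓ
  have hcont2 : Continuous (fderiv ℝ (fderiv ℝ w)) :=
    (hw.fderiv_right (m := 1) (by norm_num)).continuous_fderiv (by norm_num)
  have hΓm : MeasurableSet Γ := by
    refine hQ.measurableSet.inter ((isOpen_lt continuous_const hw.continuous).measurableSet.inter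
      (IsClosed.measurableSet ?_))
    simp only [Set.ofPred_forall]
    exact isClosed_iInter fun ξ => isClosed_le (by fun_prop) continuous_const
  have hsub : Metric.ball 0 M ⊆ grad w '' Γ := fun p hp => by
    obtain ⟨y, hy, hwy, hgy, hHy⟩ := exists_contact_point hw hQ hbd hd hQd hx₀ (p := p)
      (by simpa using hp)
    exact ⟨y, ⟨interior_subset hy, hwy, hHy⟩, hgy⟩
  have hgrad := contDiff_grad hw
  have hlow := ofReal_log_le_lintegral_ball (volume : Measure (EuclideanSpace ℝ (Fin N))) hμ hMμ.le
  have hdim : Module.finrank ℝ (EuclideanSpace ℝ (Fin N)) = N := by simp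
  rw [hdim] at hlow
  have hcov := setLIntegral_le_lintegral_abs_det_fderiv_mul volume hΓm
    (fun x _ => (hgrad.differentiable (by norm_num) x).hasFDerivAt.hasFDerivWithinAt)
    hgrad.continuous.measurable hsub (g := fun p => ENNReal.ofReal ((μ + ‖p‖)⁻¹ ^ N))
    (by fun_prop)
  have hpt : ∀ᵐ x ∂(volume.restrict Γ), ENNReal.ofReal |(fderiv ℝ (grad w) x).det|
      * ENNReal.ofReal ((μ + ‖grad w x‖)⁻¹ ^ N)
      ≤ ENNReal.ofReal (2 ^ N * lam⁻¹ ^ N) *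
        (ENNReal.ofReal (μ⁻¹) ^ N * ENNReal.ofReal (h x) ^ N + ENNReal.ofReal (β ^ N)) := by
    have hr : volume.restrict Γ ≤ volume.restrict Q :=
      Measure.restrict_mono Set.inter_subset_left le_rfl
    filter_upwards [ae_mono hr ha, ae_mono hr hL, ae_restrict_mem hΓm] with x hax hLx hxΓ
    have hdet := abs_det_le (posSemidef_neg_hess hw hxΓ.2.2) hlam hax (hLx hxΓ.2.1)
    rw [det_fderiv_grad hw, ← ENNReal.ofReal_mul (abs_nonneg _), ← ENNReal.ofReal_pow (by positivity),
      ← ENNReal.ofReal_pow (hh x), ← ENNReal.ofReal_mul (by positivity),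
      ← ENNReal.ofReal_add (mul_nonneg (by positivity) (pow_nonneg (hh x) _)) (by positivity),
      ← ENNReal.ofReal_mul (by positivity)]
    refine ENNReal.ofReal_le_ofReal ?_
    have hh' := hh x
    set P := ‖grad w x‖
    have hP : 0 ≤ P := norm_nonneg _
    calc |(hess w x).det| * (μ + P)⁻¹ ^ N
        ≤ (lam⁻¹ * (h x + β * P)) ^ N * (μ + P)⁻¹ ^ N := by gcongr
      _ = lam⁻¹ ^ N * ((h x + β * P) * (μ + P)⁻¹) ^ N := by simp only [mul_pow]; ring
      -- The weight absorbs the gradient term: h/(μ + P) ≤ h/μ and βP/(μ + P) ≤ β.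
      _ ≤ lam⁻¹ ^ N * (μ⁻¹ * h x + β) ^ N := by
          gcongr
          rw [← div_eq_mul_inv, div_le_iff₀ (by positivity)]
          have : μ⁻¹ * μ = 1 := inv_mul_cancel₀ hμ.ne'
          have h5 : 0 ≤ μ⁻¹ * h x * P := by positivity
          have h6 : 0 ≤ β * μ := by positivity
          linear_combination h5 + h6 - h x * this
      _ ≤ lam⁻¹ ^ N * (2 ^ (N - 1) * ((μ⁻¹ * h x) ^ N + β ^ N)) := by
          gcongr
          exact add_pow_le (by positivity) hβ N
      _ ≤ lam⁻¹ ^ N * (2 ^ N * ((μ⁻¹ * h x) ^ N + β ^ N)) := by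
          gcongr
          · norm_num
          · omega
      _ = _ := by rw [mul_pow]; ring
  have hup : ∫⁻ x in Γ, ENNReal.ofReal (2 ^ N * lam⁻¹ ^ N) *
        (ENNReal.ofReal (μ⁻¹) ^ N * ENNReal.ofReal (h x) ^ N + ENNReal.ofReal (β ^ N))
      ≤ ENNReal.ofReal (2 ^ N * X) := by
    refine (lintegral_mono_set Set.inter_subset_left).trans ?_
    rw [lintegral_const_mul' _ _ ENNReal.ofReal_ne_top, lintegral_add_right _ measurable_const,
      lintegral_const_mul' _ _ (ENNReal.pow_ne_top ENNReal.ofReal_ne_top), setLIntegral_const, hX,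
      ← mul_assoc, ENNReal.ofReal_mul (by positivity : (0 : ℝ) ≤ 2 ^ N * lam⁻¹ ^ N)]
    gcongr
    rw [ENNReal.ofReal_add zero_le_one (by positivity), ENNReal.ofReal_mul (by positivity),
      Measure.real, ENNReal.ofReal_toReal hQ.measure_lt_top.ne]
    gcongr
    refine (mul_le_mul_right hhμ _).trans ?_
    rw [← mul_pow, ← ENNReal.ofReal_mul (by positivity), inv_mul_cancel₀ hμ.ne']
    simp
  have hfin := hlow.trans (hcov.trans ((lintegral_mono_ae hpt).trans hup))
  rw [ENNReal.ofReal_le_ofReal_iff (by positivity)] at hfin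
  have hlog : Real.log (M / μ) ≤ 4 ^ N / (N * vB) * X := by
    have hNpos : (0 : ℝ) < N := by positivity
    rw [div_mul_eq_mul_div, le_div_iff₀ (by positivity)]
    -- One factor 2^N comes from splitting the N-th power of a sum, the other from the lower bound
    -- of the weight.
    have h4 : (4 : ℝ) ^ N = 2 ^ N * 2 ^ N := by rw [← mul_pow]; norm_num
    have h2 : (2 : ℝ) ^ N * 2⁻¹ ^ N = 1 := by rw [← mul_pow]; norm_num
    calc Real.log (M / μ) * (N * vB) = 2 ^ N * (N * vB * (2⁻¹ ^ N * Real.log (M / μ))) := by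
          linear_combination (-(N * vB * Real.log (M / μ))) * h2
      _ ≤ 2 ^ N * (2 ^ N * X) := by gcongr
      _ = _ := by rw [h4]; ring
  have hMpos : 0 < M / μ := div_pos (hμ.trans hMμ) hμ
  have := (Real.log_le_iff_le_exp hMpos).mp hlog
  rwa [div_le_iff₀ hμ, mul_comm _ μ] at this

/-! ### Mollification in L^p. -/

/-- The convolution of `g` with the normalized bump function `φ`. -/
noncomputable def mollify {N : ℕ} (φ : ContDiffBump (0 : EuclideanSpace ℝ (Fin N)))
    (g : EuclideanSpace ℝ (Fin N) → ℝ) : EuclideanSpace ℝ (Fin N) → ℝ :=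
  convolution (φ.normed volume) g (ContinuousLinearMap.lsmul ℝ ℝ) volume

section Mollify

variable {N : ℕ} (φ : ContDiffBump (0 : EuclideanSpace ℝ (Fin N)))
  {g : EuclideanSpace ℝ (Fin N) → ℝ}

theorem contDiff_mollify (hg : LocallyIntegrable g volume) {k : ℕ∞} :
    ContDiff ℝ k (mollify φ g) :=
  φ.hasCompactSupport_normed.contDiff_convolution_left _ φ.contDiff_normed hg

theorem mollify_add {g' : EuclideanSpace ℝ (Fin N) → ℝ} (hg : LocallyIntegrable g volume)
    (hg' : LocallyIntegrable g' volume) : mollify φ (g + g') = mollify φ g + mollify φ g' :=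
  ConvolutionExists.distrib_add
    (φ.hasCompactSupport_normed.convolutionExists_left _ φ.continuous_normed hg)
    (φ.hasCompactSupport_normed.convolutionExists_left _ φ.continuous_normed hg')

/-- Jensen's inequality for the probability measure with density the normalized bump, then Tonelli
and translation invariance. -/
theorem eLpNorm_mollify_le (hg : AEStronglyMeasurable g volume) {p : ℝ≥0∞} (hp : 1 ≤ p)
    (hp' : p ≠ ⊤) : eLpNorm (mollify φ g) p volume ≤ eLpNorm g p volume := by
  set ρ : Measure (EuclideanSpace ℝ (Fin N)) :=
    volume.withDensity fun t => ENNReal.ofReal (φ.normed volume t) with hρ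
  have hφm : Measurable fun t => ENNReal.ofReal (φ.normed volume t) :=
    (φ.continuous_normed.measurable).ennreal_ofReal
  have hρp : IsProbabilityMeasure ρ := by
    refine ⟨?_⟩
    rw [hρ, withDensity_apply _ MeasurableSet.univ, Measure.restrict_univ,
      ← ofReal_integral_eq_lintegral_ofReal φ.integrable_normed
        (.of_forall φ.nonneg_normed), φ.integral_normed, ENNReal.ofReal_one]
  have hp0 : p ≠ 0 := (zero_lt_one.trans_le hp).ne'
  set q := p.toReal
  have hq : 1 ≤ q := by simpa using ENNReal.toReal_mono hp' hp
  have hq0 : 0 < q := zero_lt_one.trans_le hq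
  have hac : ρ ≪ volume := withDensity_absolutelyContinuous _ _
  have hpt : ∀ x, ‖mollify φ g x‖ₑ ^ q ≤ ∫⁻ t, ‖g (x - t)‖ₑ ^ q ∂ρ := fun x => by
    have hm : AEStronglyMeasurable (fun t => g (x - t)) ρ :=
      (hg.comp_quasiMeasurePreserving (quasiMeasurePreserving_sub_left volume x)).mono_ac hac
    have h1 : ‖mollify φ g x‖ₑ ≤ ∫⁻ t, ‖g (x - t)‖ₑ ∂ρ := by
      rw [mollify, convolution_def]
      refine (enorm_integral_le_lintegral_enorm _).trans (le_of_eq ?_)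
      rw [hρ, lintegral_withDensity_eq_lintegral_mul_non_measurable _ hφm
        (.of_forall fun _ => ENNReal.ofReal_lt_top)]
      refine lintegral_congr fun t => ?_
      simp only [ContinuousLinearMap.lsmul_apply, smul_eq_mul, enorm_mul, Pi.mul_apply]
      rw [Real.enorm_of_nonneg (φ.nonneg_normed t)]
    have h2 := eLpNorm'_le_eLpNorm'_of_exponent_le one_pos hq ρ hm
    simp only [eLpNorm', ENNReal.rpow_one, div_one] at h2
    calc ‖mollify φ g x‖ₑ ^ q ≤ ((∫⁻ t, ‖g (x - t)‖ₑ ^ q ∂ρ) ^ (1 / q)) ^ q :=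
          ENNReal.rpow_le_rpow (h1.trans h2) hq0.le
      _ = _ := by
          rw [← ENNReal.rpow_mul, one_div_mul_cancel hq0.ne', ENNReal.rpow_one]
  rw [eLpNorm_eq_eLpNorm' hp0 hp', eLpNorm_eq_eLpNorm' hp0 hp', eLpNorm', eLpNorm']
  refine ENNReal.rpow_le_rpow ?_ (by positivity)
  calc ∫⁻ x, ‖mollify φ g x‖ₑ ^ q ≤ ∫⁻ x, ∫⁻ t, ‖g (x - t)‖ₑ ^ q ∂ρ := lintegral_mono hpt
    _ = ∫⁻ t, (∫⁻ x, ‖g (x - t)‖ₑ ^ q) ∂ρ := by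
        refine lintegral_lintegral_swap ?_
        exact ((hg.comp_quasiMeasurePreserving
          (quasiMeasurePreserving_sub volume ρ)).enorm).pow_const q
    _ = ∫⁻ x, ‖g x‖ₑ ^ q := by
        have : ∀ t, ∫⁻ x, ‖g (x - t)‖ₑ ^ q = ∫⁻ x, ‖g x‖ₑ ^ q :=
          fun t => lintegral_sub_right_eq_self (fun x => ‖g x‖ₑ ^ q) t
        simp [this]

end Mollify

theorem dist_mollify_le {N : ℕ} {φ : ContDiffBump (0 : EuclideanSpace ℝ (Fin N))}
    {g : EuclideanSpace ℝ (Fin N) → ℝ} (hg : AEStronglyMeasurable g volume)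
    {x : EuclideanSpace ℝ (Fin N)} {ε : ℝ}
    (h : ∀ y ∈ Metric.ball x φ.rOut, dist (g y) (g x) ≤ ε) : dist (mollify φ g x) (g x) ≤ ε :=
  ContDiffBump.dist_normed_convolution_le hg h

/-- Uniform continuity makes the difference uniformly small, and it is supported in a fixed compact
set, the closed 1-thickening of the support of `g`. -/
theorem exists_eLpNorm_mollify_sub_le_of_continuous {N : ℕ} {g : EuclideanSpace ℝ (Fin N) → ℝ}
    (hg : Continuous g) (hgc : HasCompactSupport g) (p : ℝ≥0∞) {ε : ℝ≥0∞} (hε : ε ≠ 0) :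
    ∃ δ > 0, ∀ φ : ContDiffBump (0 : EuclideanSpace ℝ (Fin N)), φ.rOut < δ →
      eLpNorm (mollify φ g - g) p volume ≤ ε := by
  set S := Metric.cthickening 1 (tsupport g)
  have hS : IsCompact S := hgc.isCompact.cthickening
  obtain ⟨η, hη, hηε⟩ : ∃ η > (0 : ℝ), volume S ^ p.toReal⁻¹ * ENNReal.ofReal η ≤ ε := by
    have hfin : volume S ^ p.toReal⁻¹ ≠ ⊤ :=
      ENNReal.rpow_ne_top_of_nonneg (by positivity) hS.measure_lt_top.ne
    obtain ⟨c, hc, hcε⟩ := ENNReal.exists_nnreal_pos_mul_lt hfin hε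
    refine ⟨c, by exact_mod_cast hc, ?_⟩
    rw [ENNReal.ofReal_coe_nnreal, mul_comm]
    exact hcε.le
  obtain ⟨δ, hδ, hδη⟩ := Metric.uniformContinuous_iff.mp
    (hgc.uniformContinuous_of_continuous hg) η hη
  refine ⟨min δ 1, lt_min hδ one_pos, fun φ hφ => ?_⟩
  have hb : ∀ x, ‖(mollify φ g - g) x‖ ≤ η := fun x => by
    rw [Pi.sub_apply, ← dist_eq_norm]
    refine dist_mollify_le hg.aestronglyMeasurable fun y hy => (hδη ?_).le
    exact (Metric.mem_ball.mp hy).trans (hφ.trans_le (min_le_left _ _))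
  have hsupp : Function.support (mollify φ g - g) ⊆ S := by
    intro x hx
    by_contra hxS
    have hdist : ∀ y ∈ Metric.ball x φ.rOut, g y = 0 := fun y hy => by
      refine image_eq_zero_of_notMem_tsupport fun hy' => hxS ?_
      refine Metric.mem_cthickening_of_dist_le x y 1 _ hy' ?_
      rw [dist_comm]
      exact (Metric.mem_ball.mp hy).le.trans (hφ.le.trans (min_le_right _ _))
    have hx0 : g x = 0 := hdist x (Metric.mem_ball_self φ.rOut_pos)
    have h0 : dist (mollify φ g x) (g x) ≤ 0 :=
      dist_mollify_le hg.aestronglyMeasurable fun y hy => by rw [hdist y hy, hx0, dist_self]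
    exact hx (by simpa [sub_eq_zero] using dist_le_zero.mp h0)
  rw [← Set.indicator_eq_self.mpr hsupp,
    eLpNorm_indicator_eq_eLpNorm_restrict hS.measurableSet]
  refine (eLpNorm_le_of_ae_bound (.of_forall hb)).trans ?_
  rwa [Measure.restrict_apply_univ]

/-- Density of compactly supported continuous functions, with mollification being an L^p
contraction. -/
theorem exists_eLpNorm_mollify_sub_le {N : ℕ} {g : EuclideanSpace ℝ (Fin N) → ℝ} {p : ℝ≥0∞}
    (hp : 1 ≤ p) (hp' : p ≠ ⊤) (hg : MemLp g p volume) {ε : ℝ≥0∞} (hε : ε ≠ 0) :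
    ∃ δ > 0, ∀ φ : ContDiffBump (0 : EuclideanSpace ℝ (Fin N)), φ.rOut < δ →
      eLpNorm (mollify φ g - g) p volume ≤ ε := by
  have hε3 : ε / 3 ≠ 0 := by simp [ENNReal.div_eq_zero_iff, hε]
  obtain ⟨g', hg'c, hgg', hg'cont, hg'p⟩ := hg.exists_hasCompactSupport_eLpNorm_sub_le hp' hε3
  obtain ⟨δ, hδ, H⟩ := exists_eLpNorm_mollify_sub_le_of_continuous hg'cont hg'c p hε3
  refine ⟨δ, hδ, fun φ hφ => ?_⟩
  have hsub : MemLp (g - g') p volume := hg.sub hg'p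
  have h1 : mollify φ g = mollify φ (g - g') + mollify φ g' := by
    rw [← mollify_add φ (hsub.locallyIntegrable hp) (hg'p.locallyIntegrable hp), sub_add_cancel]
  have h2 : mollify φ g - g = mollify φ (g - g') + (mollify φ g' - g') - (g - g') := by
    rw [h1]; abel
  have hm1 : AEStronglyMeasurable (mollify φ (g - g')) volume :=
    (contDiff_mollify φ (hsub.locallyIntegrable hp) (k := 0)).continuous.aestronglyMeasurable
  have hm2 : AEStronglyMeasurable (mollify φ g' - g') volume :=
    ((contDiff_mollify φ (hg'p.locallyIntegrable hp) (k := 0)).continuous.sub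
      hg'cont).aestronglyMeasurable
  rw [h2]
  calc _ ≤ eLpNorm (mollify φ (g - g') + (mollify φ g' - g')) p volume
        + eLpNorm (g - g') p volume := eLpNorm_sub_le (hm1.add hm2) hsub.1 hp
    _ ≤ (eLpNorm (mollify φ (g - g')) p volume + eLpNorm (mollify φ g' - g') p volume)
        + eLpNorm (g - g') p volume := by gcongr; exact eLpNorm_add_le hm1 hm2 hp
    _ ≤ (ε / 3 + ε / 3) + ε / 3 := by
        gcongr
        · exact (eLpNorm_mollify_le φ hsub.1 hp hp').trans hgg'
        · exact H φ hφ
    _ = ε := ENNReal.add_thirds ε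

/-! ### Weak derivatives. -/

section Weak

variable {N : ℕ} {Ω K : Set (EuclideanSpace ℝ (Fin N))} {i j : Fin N}
  {u v : EuclideanSpace ℝ (Fin N) → ℝ}

theorem integrable_indicator_of_isCompact (hu : LocallyIntegrableOn u Ω volume) (hK : IsCompact K)
    (hKΩ : K ⊆ Ω) : Integrable (K.indicator u) volume :=
  (integrable_indicator_iff hK.measurableSet).mpr (hu.integrableOn_compact_subset hKΩ hK)

theorem setIntegral_mul_eq_integral_indicator_mul (hKΩ : K ⊆ Ω)
    {θ : EuclideanSpace ℝ (Fin N) → ℝ} (hθ : ∀ x, x ∉ K → θ x = 0) :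
    ∫ x in Ω, u x * θ x = ∫ x, K.indicator u x * θ x := by
  rw [setIntegral_eq_integral_of_forall_compl_eq_zero fun x hx => by
    rw [hθ x fun hxK => hx (hKΩ hxK), mul_zero]]
  congr 1 with x
  by_cases hx : x ∈ K
  · rw [Set.indicator_of_mem hx]
  · rw [hθ x hx, mul_zero, mul_zero]

/-- Mollification commutes with weak derivatives away from the boundary. -/
theorem fderiv_mollify_indicator (h : HasWeakPartial Ω i u v) (hK : IsCompact K)
    (hKΩ : K ⊆ Ω) (φ : ContDiffBump (0 : EuclideanSpace ℝ (Fin N)))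
    {x : EuclideanSpace ℝ (Fin N)} (hx : Metric.closedBall x φ.rOut ⊆ K) :
    fderiv ℝ (mollify φ (K.indicator u)) x (EuclideanSpace.single i 1)
      = mollify φ (K.indicator v) x := by
  set e : EuclideanSpace ℝ (Fin N) := EuclideanSpace.single i 1
  set ρ := φ.normed (volume : Measure (EuclideanSpace ℝ (Fin N)))
  have hρ : ContDiff ℝ ∞ ρ := φ.contDiff_normed
  have hρc : HasCompactSupport ρ := φ.hasCompactSupport_normed
  have hui := integrable_indicator_of_isCompact h.locallyIntegrable hK hKΩ
  have hd := hρc.hasFDerivAt_convolution_left (ContinuousLinearMap.lsmul ℝ ℝ)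
    (hρ.of_le (by exact_mod_cast le_top)) hui.locallyIntegrable x
  have hex := (hρc.fderiv (𝕜 := ℝ)).convolutionExists_left
    ((ContinuousLinearMap.lsmul ℝ ℝ : ℝ →L[ℝ] ℝ →L[ℝ] ℝ).precompL (EuclideanSpace ℝ (Fin N)))
    (hρ.continuous_fderiv (by simp)) hui.locallyIntegrable x
  -- The reflected kernel centred at `x` is supported in `K`, hence an admissible test function;
  -- cutting off `u` and `v` outside `K` is invisible to it.
  set ψ : EuclideanSpace ℝ (Fin N) → ℝ := fun t => ρ (x - t) with hψ
  have hψs : ContDiff ℝ ∞ ψ := hρ.comp (contDiff_const.sub contDiff_id)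
  have hψ0 : ∀ t, t ∉ Metric.closedBall x φ.rOut → ψ t = 0 := fun t ht => by
    refine image_eq_zero_of_notMem_tsupport (f := ρ) ?_
    rw [φ.tsupport_normed_eq]
    simpa [dist_eq_norm, norm_sub_rev] using ht
  have hψt : tsupport ψ ⊆ Metric.closedBall x φ.rOut :=
    closure_minimal (fun t ht => by_contra fun hn => ht (hψ0 t hn)) Metric.isClosed_closedBall
  have hψc : HasCompactSupport ψ :=
    (isCompact_closedBall x φ.rOut).of_isClosed_subset (isClosed_tsupport ψ) hψt
  have hfψ : ∀ t, fderiv ℝ ψ t e = - fderiv ℝ ρ (x - t) e := fun t => by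
    have h1 : HasFDerivAt ψ ((fderiv ℝ ρ (x - t)).comp
        (-ContinuousLinearMap.id ℝ (EuclideanSpace ℝ (Fin N)))) t :=
      ((hρ.differentiable (by simp)) (x - t)).hasFDerivAt.comp t ((hasFDerivAt_id t).const_sub x)
    rw [h1.fderiv]
    simp
  have hfψ0 : ∀ t, t ∉ K → fderiv ℝ ψ t = 0 := fun t ht =>
    image_eq_zero_of_notMem_tsupport fun hn => ht (hx (hψt (tsupport_fderiv_subset ℝ hn)))
  have hmain : ∫ t in Ω, u t * fderiv ℝ ψ t e = -∫ t in Ω, v t * ψ t := h.integral_eq ψ hψs hψc (hψt.trans (hx.trans hKΩ))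
  rw [setIntegral_mul_eq_integral_indicator_mul hKΩ fun t ht => by rw [hfψ0 t ht]; rfl,
    setIntegral_mul_eq_integral_indicator_mul hKΩ fun t ht => hψ0 t fun hn => ht (hx hn)] at hmain
  have hlhs : fderiv ℝ (mollify φ (K.indicator u)) x e
      = ∫ t, fderiv ℝ ρ (x - t) e * K.indicator u t := by
    rw [mollify, hd.fderiv, convolution_def, ContinuousLinearMap.integral_apply hex,
      ← integral_sub_left_eq_self _ volume x]
    simp [ContinuousLinearMap.precompL_apply]
  rw [hlhs, mollify, convolution_eq_swap]
  simp only [ContinuousLinearMap.lsmul_apply, smul_eq_mul]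
  simp only [hfψ, mul_neg, integral_neg, neg_inj] at hmain
  simpa only [mul_comm] using hmain

theorem hess_mollify_indicator {w : EuclideanSpace ℝ (Fin N) → ℝ} (h : HasWeakPartial Ω j u v)
    (h' : HasWeakPartial Ω i v w) (hK : IsCompact K)
    (hKΩ : K ⊆ Ω) (φ : ContDiffBump (0 : EuclideanSpace ℝ (Fin N)))
    {x : EuclideanSpace ℝ (Fin N)} {δ : ℝ} (hφ : φ.rOut < δ) (hx : Metric.ball x δ ⊆ K) :
    hess (mollify φ (K.indicator u)) x i j = mollify φ (K.indicator w) x := by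
  have hev : (fun y => fderiv ℝ (mollify φ (K.indicator u)) y (EuclideanSpace.single j 1))
      =ᶠ[nhds x] mollify φ (K.indicator v) := by
    filter_upwards [Metric.ball_mem_nhds x (sub_pos.mpr hφ)] with y hy
    refine fderiv_mollify_indicator h hK hKΩ φ fun z hz => hx ?_
    rw [Metric.mem_ball] at hy ⊢
    rw [Metric.mem_closedBall] at hz
    linarith [dist_triangle z y x]
  rw [hess, Matrix.of_apply, hev.fderiv_eq]
  exact fderiv_mollify_indicator h' hK hKΩ φ
    ((Metric.closedBall_subset_ball hφ).trans hx)

/-- Two integrations by parts move both derivatives to the test function, whose Hessian is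
symmetric; conclude by the fundamental lemma of the calculus of variations. -/
theorem weak_hess_symm (hΩ : IsOpen Ω) {Du : Fin N → EuclideanSpace ℝ (Fin N) → ℝ}
    {D2u : Fin N → Fin N → EuclideanSpace ℝ (Fin N) → ℝ}
    (h : ∀ i, HasWeakPartial Ω i u (Du i)) (h' : ∀ i j, HasWeakPartial Ω i (Du j) (D2u i j))
    (i j : Fin N) : ∀ᵐ x ∂(volume.restrict Ω), D2u i j x = D2u j i x := by
  have key : ∀ (i j : Fin N) (φ : EuclideanSpace ℝ (Fin N) → ℝ), ContDiff ℝ ∞ φ →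
      HasCompactSupport φ → tsupport φ ⊆ Ω →
      ∫ x in Ω, D2u i j x * φ x = ∫ x in Ω, u x * hess φ x j i := fun i j φ hφ hφc hφΩ => by
    have h1 := (h' i j).integral_eq φ hφ hφc hφΩ
    have hs : tsupport (fun x => fderiv ℝ φ x (EuclideanSpace.single i 1)) ⊆ tsupport φ :=
      tsupport_fderiv_apply_subset ℝ _
    have h2 := (h j).integral_eq (fun x => fderiv ℝ φ x (EuclideanSpace.single i 1))
      ((hφ.fderiv_right (m := ∞) (by simp)).clm_apply contDiff_const)
      (hφc.of_isClosed_subset (isClosed_tsupport _) hs) (hs.trans hφΩ)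
    simp only [hess, Matrix.of_apply]
    linarith
  have hint : ∀ (i j : Fin N) (φ : EuclideanSpace ℝ (Fin N) → ℝ), ContDiff ℝ ∞ φ →
      HasCompactSupport φ → tsupport φ ⊆ Ω → Integrable (fun x => D2u i j x * φ x) volume ∧
        ∫ x, D2u i j x * φ x = ∫ x in Ω, D2u i j x * φ x := fun i j φ hφ hφc hφΩ => by
    have h1 : IntegrableOn (fun x => D2u i j x * φ x) (tsupport φ) volume :=
      ((h' i j).locallyIntegrable_deriv.integrableOn_compact_subset hφΩ hφc).mul_continuousOn
        hφ.continuous.continuousOn hφc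
    have h0 : ∀ x, x ∉ tsupport φ → D2u i j x * φ x = 0 := fun x hx => by
      rw [image_eq_zero_of_notMem_tsupport hx, mul_zero]
    exact ⟨(integrableOn_iff_integrable_of_support_subset
      (fun x hx => by_contra fun hn => hx (h0 x hn))).mp h1,
      (setIntegral_eq_integral_of_forall_compl_eq_zero fun x hx => h0 x fun hn => hx (hφΩ hn)).symm⟩
  have hae := hΩ.ae_eq_zero_of_integral_contDiff_smul_eq_zero
    ((h' i j).locallyIntegrable_deriv.sub (h' j i).locallyIntegrable_deriv)
    (μ := volume) fun φ hφ hφc hφΩ => by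
      have h1 := hint i j φ hφ hφc hφΩ
      have h2 := hint j i φ hφ hφc hφΩ
      have hsplit : ∀ x, φ x • (D2u i j - D2u j i) x = D2u i j x * φ x - D2u j i x * φ x :=
        fun x => by simp only [Pi.sub_apply, smul_eq_mul]; ring
      simp only [hsplit]
      rw [integral_sub h1.1 h2.1, h1.2, h2.2, key i j φ hφ hφc hφΩ, key j i φ hφ hφc hφΩ,
        sub_eq_zero]
      congr 1 with x
      rw [hess_symm (contDiff_infty.mp hφ 2) x j i]
  rw [ae_restrict_iff' hΩ.measurableSet]
  filter_upwards [hae] with x hx hxΩ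
  exact sub_eq_zero.mp (hx hxΩ)

end Weak

/-! ### Symmetrized coefficients and interior approximation. -/

theorem sum_symmetrize_mul {N : ℕ} (a S : Fin N → Fin N → ℝ) (hS : ∀ i j, S i j = S j i) :
    ∑ i, ∑ j, (a i j + a j i) / 2 * S i j = ∑ i, ∑ j, a i j * S i j := by
  have h : ∑ i, ∑ j, a j i * S i j = ∑ i, ∑ j, a i j * S i j := by
    rw [Finset.sum_comm]
    exact Finset.sum_congr rfl fun i _ => Finset.sum_congr rfl fun j _ => by rw [hS]
  have h2 : ∑ i, ∑ j, (a i j + a j i) / 2 * S i j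
      = (∑ i, ∑ j, a i j * S i j + ∑ i, ∑ j, a j i * S i j) / 2 := by
    simp only [← Finset.sum_add_distrib, Finset.sum_div]
    exact Finset.sum_congr rfl fun i _ => Finset.sum_congr rfl fun j _ => by ring
  rw [h2, h]
  ring

/-- The quadratic form sees only the symmetric part of `a`, so only that part has bounded entries.
They are read off from the vectors e_i ± e_j. -/
theorem abs_symmetrize_le {N : ℕ} {a : Fin N → Fin N → ℝ} {Lam : ℝ}
    (h0 : ∀ ξ : EuclideanSpace ℝ (Fin N), 0 ≤ ∑ i, ∑ j, a i j * ξ i * ξ j)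
    (h1 : ∀ ξ : EuclideanSpace ℝ (Fin N), ∑ i, ∑ j, a i j * ξ i * ξ j ≤ Lam * ‖ξ‖ ^ 2)
    (hLam : 0 ≤ Lam) (i j : Fin N) : |(a i j + a j i) / 2| ≤ Lam := by
  have hval : ∀ s : ℝ, ∑ k, ∑ l, a k l
      * (EuclideanSpace.single i (1 : ℝ) + EuclideanSpace.single j s : EuclideanSpace ℝ (Fin N)) k
      * (EuclideanSpace.single i (1 : ℝ) + EuclideanSpace.single j s : EuclideanSpace ℝ (Fin N)) l
      = a i i + s * (a i j + a j i) + s ^ 2 * a j j := fun s => by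
    simp only [PiLp.add_apply, PiLp.single_apply, mul_add, add_mul, Finset.sum_add_distrib,
      mul_ite, mul_one, mul_zero, ite_mul, zero_mul, Finset.sum_ite_eq', Finset.mem_univ, if_true]
    ring
  -- The bound 4, rather than 2, also covers i = j.
  have hnorm : ∀ s : ℝ, |s| = 1 → ‖(EuclideanSpace.single i (1 : ℝ) + EuclideanSpace.single j s :
      EuclideanSpace ℝ (Fin N))‖ ^ 2 ≤ 4 := fun s hs => by
    have h := norm_add_le (EuclideanSpace.single i (1 : ℝ)) (EuclideanSpace.single j s)
    rw [PiLp.norm_single, PiLp.norm_single, Real.norm_eq_abs s, hs, norm_one] at h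
    calc _ ≤ (1 + 1 : ℝ) ^ 2 := pow_le_pow_left₀ (norm_nonneg _) h 2
      _ = 4 := by norm_num
  have hb : ∀ s : ℝ, |s| = 1 → a i i + s * (a i j + a j i) + s ^ 2 * a j j ≤ Lam * 4 ∧
      0 ≤ a i i + s * (a i j + a j i) + s ^ 2 * a j j := fun s hs => by
    rw [← hval s]
    exact ⟨(h1 _).trans (mul_le_mul_of_nonneg_left (hnorm s hs) hLam), h0 _⟩
  have hp := hb 1 (by simp)
  have hm := hb (-1) (by simp)
  rw [abs_le]
  constructor <;> linarith [hp.1, hp.2, hm.1, hm.2]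

/-- Interior approximation of a `W^{2,p}_loc` function by `C²` functions. -/
theorem exists_contDiff_approx {N : ℕ} {Ω K : Set (EuclideanSpace ℝ (Fin N))} (hΩ : IsOpen Ω)
    (hK : IsCompact K) (hKΩ : K ⊆ Ω) {p : ℝ≥0∞} (hp : 1 ≤ p) (hp' : p ≠ ⊤)
    {u : EuclideanSpace ℝ (Fin N) → ℝ} {Du : Fin N → EuclideanSpace ℝ (Fin N) → ℝ}
    {D2u : Fin N → Fin N → EuclideanSpace ℝ (Fin N) → ℝ} (hu : IsW2Loc p Ω u Du D2u)
    (huc : ContinuousOn u Ω) {η : ℝ} (hη : 0 < η) :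
    ∃ w : EuclideanSpace ℝ (Fin N) → ℝ, ContDiff ℝ 2 w ∧ (∀ x ∈ K, |w x - u x| ≤ η) ∧
      (∀ j, eLpNorm (fun x => grad w x j - Du j x) p (volume.restrict K) ≤ ENNReal.ofReal η) ∧
      ∀ i j, eLpNorm (fun x => hess w x i j - D2u i j x) p (volume.restrict K)
        ≤ ENNReal.ofReal η := by
  -- The thickening leaves room to mollify: cut off outside `K'`, the functions are global and
  -- unchanged on the `δ₀`-balls around points of `K`.
  obtain ⟨δ₀, hδ₀, hδΩ⟩ := hK.exists_cthickening_subset_open hΩ hKΩ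
  set K' := Metric.cthickening δ₀ K
  have hK' : IsCompact K' := hK.cthickening
  have hball : ∀ x ∈ K, Metric.ball x δ₀ ⊆ K' := fun x hx y hy =>
    Metric.mem_cthickening_of_dist_le y x δ₀ K hx (Metric.mem_ball.mp hy).le
  have hKK' : K ⊆ K' := Metric.self_subset_cthickening K
  have hLp : ∀ g, MemLpLoc p Ω g → ∀ᶠ δ in nhdsWithin (0 : ℝ) (Set.Ioi 0),
      ∀ φ : ContDiffBump (0 : EuclideanSpace ℝ (Fin N)), φ.rOut < δ →
        eLpNorm (fun x => mollify φ (K'.indicator g) x - g x) p (volume.restrict K)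
          ≤ ENNReal.ofReal η := fun g hg => by
    obtain ⟨δ, hδ, H⟩ := exists_eLpNorm_mollify_sub_le hp hp'
      ((memLp_indicator_iff_restrict hK'.measurableSet).mpr (hg K' hK' hδΩ))
      (ENNReal.ofReal_pos.mpr hη).ne'
    filter_upwards [Ioo_mem_nhdsGT hδ] with δ' hδ' φ hφ
    refine le_trans ?_ (H φ (hφ.trans hδ'.2))
    refine le_trans (le_of_eq (eLpNorm_congr_ae ?_)) (eLpNorm_restrict_le _ _ _ K)
    filter_upwards [ae_restrict_mem hK.measurableSet] with x hx
    rw [Pi.sub_apply, Set.indicator_of_mem (hKK' hx)]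
  have hunif : ∀ᶠ δ in nhdsWithin (0 : ℝ) (Set.Ioi 0), ∀ x ∈ K', ∀ y ∈ K', dist x y < δ →
      dist (u x) (u y) < η := by
    obtain ⟨δ, hδ, H⟩ := Metric.uniformContinuousOn_iff.mp
      (hK'.uniformContinuousOn_of_continuous (huc.mono hδΩ)) η hη
    filter_upwards [Ioo_mem_nhdsGT hδ] with δ' hδ' x hx y hy hxy
    exact H x hx y hy (hxy.trans hδ'.2)
  obtain ⟨δ, ⟨⟨hgrad, hhess⟩, hun⟩, hδ, hδδ₀⟩ :=
    ((((Filter.eventually_all.mpr fun j => hLp _ (hu.memLp_grad j)).and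
      (Filter.eventually_all.mpr fun i => Filter.eventually_all.mpr fun j =>
        hLp _ (hu.memLp_hess i j))).and hunif).and (Ioo_mem_nhdsGT hδ₀)).exists
  let φ : ContDiffBump (0 : EuclideanSpace ℝ (Fin N)) :=
    ⟨δ / 4, δ / 2, by positivity, by linarith⟩
  have hφ : φ.rOut < δ := half_lt_self hδ
  have hui : Integrable (K'.indicator u) volume := by
    refine (integrable_indicator_iff hK'.measurableSet).mpr ?_
    exact (huc.mono hδΩ).integrableOn_compact hK'
  refine ⟨mollify φ (K'.indicator u), ?_, fun x hx => ?_, fun j => ?_, fun i j => ?_⟩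
  · exact_mod_cast contDiff_mollify φ hui.locallyIntegrable (k := 2)
  · have hd := dist_mollify_le (φ := φ) (x := x) (g := K'.indicator u) (ε := η)
      hui.aestronglyMeasurable fun y hy => by
        have hy' := hball x hx (Metric.ball_subset_ball (hφ.trans hδδ₀).le hy)
        rw [Set.indicator_of_mem hy', Set.indicator_of_mem (hKK' hx)]
        exact (hun y hy' x (hKK' hx) ((Metric.mem_ball.mp hy).trans hφ)).le
    rwa [Set.indicator_of_mem (hKK' hx), Real.dist_eq] at hd
  · refine le_trans (le_of_eq (eLpNorm_congr_ae ?_)) (hgrad j φ hφ)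
    filter_upwards [ae_restrict_mem hK.measurableSet] with x hx
    rw [← fderiv_mollify_indicator (hu.weak_grad j) hK' hδΩ φ
      ((Metric.closedBall_subset_ball (hφ.trans hδδ₀)).trans (hball x hx))]
    rfl
  · refine le_trans (le_of_eq (eLpNorm_congr_ae ?_)) (hhess i j φ hφ)
    filter_upwards [ae_restrict_mem hK.measurableSet] with x hx
    rw [hess_mollify_indicator (hu.weak_grad j) (hu.weak_hess i j) hK' hδΩ φ (hφ.trans hδδ₀)
      (hball x hx)]

/-! ### Bounds for the size of the data and for the approximation error. -/

theorem le_coeffSize {lam Lam c₁ c₂ : ℝ} (hlam : 0 < lam) :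
    lam⁻¹ ≤ coeffSize lam Lam c₁ c₂ ∧ c₁ ≤ coeffSize lam Lam c₁ c₂ ∧
      1 ≤ coeffSize lam Lam c₁ c₂ := by
  have h1 : lam ≤ coeffSize lam Lam c₁ c₂ := by simp [coeffSize]
  have h2 : lam⁻¹ ≤ coeffSize lam Lam c₁ c₂ := by simp [coeffSize]
  refine ⟨h2, by simp [coeffSize], ?_⟩
  rcases le_total 1 lam with h | h
  · exact h.trans h1
  · exact ((one_le_inv₀ hlam).mpr h).trans h2

theorem lintegral_ofReal_pow_le {α : Type*} [MeasurableSpace α] {ν : Measure α} {N : ℕ}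
    (hN : N ≠ 0) {h : α → ℝ} (hh : ∀ x, 0 ≤ h x) {μ : ℝ}
    (hμ : eLpNorm h (N : ℝ≥0∞) ν ≤ ENNReal.ofReal μ) :
    ∫⁻ x, ENNReal.ofReal (h x) ^ N ∂ν ≤ ENNReal.ofReal μ ^ N := by
  rw [eLpNorm_eq_lintegral_rpow_enorm_toReal (by exact_mod_cast hN) (by simp)] at hμ
  have h1 := pow_le_pow_left₀ zero_le hμ N
  rw [ENNReal.toReal_natCast, one_div, ENNReal.rpow_inv_natCast_pow hN] at h1
  refine le_trans (le_of_eq (lintegral_congr fun x => ?_)) h1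
  rw [ENNReal.rpow_natCast, Real.enorm_of_nonneg (hh x)]

theorem eLpNorm_mul_abs_le {α : Type*} [MeasurableSpace α] {ν : Measure α} {p : ℝ≥0∞}
    {g : α → ℝ} {c : ℝ} (hc : 0 ≤ c) {η : ℝ≥0∞} (hg : eLpNorm g p ν ≤ η) :
    eLpNorm (fun x => c * |g x|) p ν ≤ ENNReal.ofReal c * η := by
  have h : eLpNorm (fun x => c * |g x|) p ν = ENNReal.ofReal c * eLpNorm g p ν := by
    rw [← Real.enorm_of_nonneg hc, ← eLpNorm_norm g, ← eLpNorm_const_smul]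
    rfl
  rw [h]
  gcongr

theorem eLpNorm_error_le {N : ℕ} {α : Type*} [MeasurableSpace α] {ν : Measure α} {p : ℝ≥0∞}
    (hp : 1 ≤ p) {A : Fin N → Fin N → α → ℝ} {B : Fin N → α → ℝ} {D f : α → ℝ} {α₀ β₀ γ₀ η : ℝ≥0∞}
    (hf : AEStronglyMeasurable f ν) (hAm : ∀ i j, AEStronglyMeasurable (A i j) ν)
    (hBm : ∀ i, AEStronglyMeasurable (B i) ν) (hDm : AEStronglyMeasurable D ν)
    (hA : ∀ i j, eLpNorm (A i j) p ν ≤ α₀ * η) (hB : ∀ i, eLpNorm (B i) p ν ≤ β₀ * η)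
    (hD : eLpNorm D p ν ≤ γ₀ * η) :
    eLpNorm (f + (((∑ i, ∑ j, A i j) + ∑ i, B i) + D)) p ν
      ≤ eLpNorm f p ν + η * ((N * (N * α₀) + N * β₀) + γ₀) := by
  have hA1 : ∀ i, AEStronglyMeasurable (∑ j, A i j) ν :=
    fun i => Finset.aestronglyMeasurable_sum _ fun j _ => hAm i j
  have hA2 : AEStronglyMeasurable (∑ i, ∑ j, A i j) ν :=
    Finset.aestronglyMeasurable_sum _ fun i _ => hA1 i
  have hB1 : AEStronglyMeasurable (∑ i, B i) ν :=
    Finset.aestronglyMeasurable_sum _ fun i _ => hBm i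
  have hAs : eLpNorm (∑ i, ∑ j, A i j) p ν ≤ N * (N * (α₀ * η)) := by
    refine (eLpNorm_sum_le (fun i _ => hA1 i) hp).trans ?_
    refine (Finset.sum_le_sum fun i _ => (eLpNorm_sum_le (fun j _ => hAm i j) hp).trans
      (Finset.sum_le_sum fun j _ => hA i j)).trans ?_
    simp
  have hBs : eLpNorm (∑ i, B i) p ν ≤ N * (β₀ * η) := by
    refine (eLpNorm_sum_le (fun i _ => hBm i) hp).trans ?_
    refine (Finset.sum_le_sum fun i _ => hB i).trans ?_
    simp
  refine (eLpNorm_add_le hf ((hA2.add hB1).add hDm) hp).trans ?_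
  gcongr
  refine (eLpNorm_add_le (hA2.add hB1) hDm hp).trans ?_
  refine (add_le_add (eLpNorm_add_le hA2 hB1 hp) hD).trans ?_
  refine (add_le_add (add_le_add hAs hBs) le_rfl).trans (le_of_eq ?_)
  ring

theorem grad_sub_const {N : ℕ} (w : EuclideanSpace ℝ (Fin N) → ℝ) (k : ℝ) :
    grad (fun x => w x - k) = grad w := by
  ext x j
  simp [grad, fderiv_sub_const]

theorem hess_sub_const {N : ℕ} (w : EuclideanSpace ℝ (Fin N) → ℝ) (k : ℝ) :
    hess (fun x => w x - k) = hess w := by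
  ext x i j
  simp [hess, fderiv_sub_const]

/-- Transfers the differential inequality from u to its approximation, whose value, gradient and
Hessian are `wv`, `G`, `H`. Since c ≤ 0 ≤ `wv`, the zeroth order term is dropped; `c₂` enters only
through c(`wv` - `uv`). -/
theorem neg_le_sum_hess {N : ℕ} {a : Fin N → Fin N → ℝ} {b : Fin N → ℝ} {c : ℝ}
    {Lam c₁ c₂ f uv wv : ℝ} {Du : Fin N → ℝ} {D2u H : Fin N → Fin N → ℝ}
    {G : EuclideanSpace ℝ (Fin N)}
    (ha : ∀ i j, |a i j| ≤ Lam) (hb : ∀ i, |b i| ≤ c₁) (hc : |c| ≤ c₂) (hc0 : c ≤ 0)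
    (hw : 0 ≤ wv) (hf : f ≤ (∑ i, ∑ j, a i j * D2u i j) + (∑ i, b i * Du i) + c * uv) :
    -((|f| + ((∑ i, ∑ j, Lam * |H i j - D2u i j|) + (∑ i, c₁ * |G i - Du i|) + c₂ * |wv - uv|))
      + c₁ * N * ‖G‖) ≤ ∑ i, ∑ j, a i j * H i j := by
  have hmul : ∀ {r s t : ℝ}, |r| ≤ s → -(s * |t|) ≤ r * t := fun {r s t} h => by
    have h1 : |r * t| ≤ s * |t| := by
      rw [abs_mul]
      exact mul_le_mul_of_nonneg_right h (abs_nonneg t)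
    linarith [neg_abs_le (r * t)]
  have h1 : -(∑ i, ∑ j, Lam * |H i j - D2u i j|) ≤ ∑ i, ∑ j, a i j * (H i j - D2u i j) := by
    simp only [← Finset.sum_neg_distrib]
    exact Finset.sum_le_sum fun i _ => Finset.sum_le_sum fun j _ => hmul (ha i j)
  have h2 : -(∑ i, c₁ * |G i - Du i|) ≤ ∑ i, b i * (G i - Du i) := by
    simp only [← Finset.sum_neg_distrib]
    exact Finset.sum_le_sum fun i _ => hmul (hb i)
  have h3 : ∑ i, b i * G i ≤ c₁ * N * ‖G‖ := by
    calc ∑ i, b i * G i ≤ ∑ _i : Fin N, c₁ * ‖G‖ := Finset.sum_le_sum fun i _ => by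
          have hGi : |G i| ≤ ‖G‖ := by simpa using PiLp.norm_apply_le G i
          calc b i * G i ≤ |b i * G i| := le_abs_self _
            _ = |b i| * |G i| := abs_mul _ _
            _ ≤ c₁ * ‖G‖ := mul_le_mul (hb i) hGi (abs_nonneg _) ((abs_nonneg _).trans (hb i))
      _ = c₁ * N * ‖G‖ := by simp; ring
  have h4 : -(c₂ * |wv - uv|) ≤ c * (wv - uv) := hmul hc
  have h5 : c * wv ≤ 0 := mul_nonpos_of_nonpos_of_nonneg hc0 hw
  simp only [mul_sub, Finset.sum_sub_distrib] at h1 h2 h4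
  linarith [neg_abs_le f]

/-! ### From C² functions to Sobolev functions. -/

/-- The maximum estimate, up to small errors `ε` and `μ - ‖f‖`. -/
theorem le_add_of_lt {N : ℕ} [NeZero N] {Ω : Set (EuclideanSpace ℝ (Fin N))} (hΩ : IsOpen Ω)
    (hΩb : Bornology.IsBounded Ω) {lam Lam c₁ c₂ : ℝ} (hlam : 0 < lam) (hLam : 0 < Lam)
    (hc₁ : 0 < c₁) (hc₂ : 0 < c₂)
    {a : Fin N → Fin N → EuclideanSpace ℝ (Fin N) → ℝ} {b : Fin N → EuclideanSpace ℝ (Fin N) → ℝ}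
    {c : EuclideanSpace ℝ (Fin N) → ℝ} (hco : CoeffBounds Ω a b c lam Lam c₁ c₂)
    {f : EuclideanSpace ℝ (Fin N) → ℝ} (hf : MemLp f N (volume.restrict Ω))
    {u : EuclideanSpace ℝ (Fin N) → ℝ} {Du : Fin N → EuclideanSpace ℝ (Fin N) → ℝ}
    {D2u : Fin N → Fin N → EuclideanSpace ℝ (Fin N) → ℝ} (hu0 : IsC00 Ω u)
    (hu : IsW2Loc N Ω u Du D2u)
    (hLu : ∀ᵐ x ∂(volume.restrict Ω), f x ≤ ellipticOp a b c u Du D2u x)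
    {ε μ : ℝ} (hε : 0 < ε) (hμ : (eLpNorm f N (volume.restrict Ω)).toReal < μ)
    {x₀ : EuclideanSpace ℝ (Fin N)} (hx₀ : x₀ ∈ Ω) :
    u x₀ ≤ 3 * ε + Metric.diam Ω * μ * Real.exp (4 ^ N / (N *
      volume.real (Metric.ball (0 : EuclideanSpace ℝ (Fin N)) 1))
        * (lam⁻¹ ^ N * (1 + (c₁ * N) ^ N * volume.real Ω))) := by
  have hN : 0 < N := NeZero.pos N
  have hnt : Nontrivial (EuclideanSpace ℝ (Fin N)) :=
    Module.nontrivial_of_finrank_pos (R := ℝ) (by simpa using hN)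
  have hp : (1 : ℝ≥0∞) ≤ N := by exact_mod_cast hN
  have hp' : (N : ℝ≥0∞) ≠ ⊤ := by simp
  have hd : 0 < Metric.diam Ω :=
    Metric.diam_pos (infinite_of_mem_nhds x₀ (hΩ.mem_nhds hx₀)).nontrivial hΩb
  have hμ0 : 0 < μ := ENNReal.toReal_nonneg.trans_lt hμ
  rcases lt_or_ge (u x₀) ε with hlt | hge
  · have : 0 ≤ Metric.diam Ω * μ * Real.exp (4 ^ N / (N *
      volume.real (Metric.ball (0 : EuclideanSpace ℝ (Fin N)) 1))
        * (lam⁻¹ ^ N * (1 + (c₁ * N) ^ N * volume.real Ω))) := by positivity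
    linarith
  -- the superlevel set is a compact subset of `Ω`
  set K₀ := closure Ω ∩ u ⁻¹' Set.Ici ε with hK₀def
  have hK₀ : IsCompact K₀ := hΩb.isCompact_closure.of_isClosed_subset
    (hu0.continuousOn.preimage_isClosed_of_isClosed isClosed_closure isClosed_Ici)
    Set.inter_subset_left
  have hK₀Ω : K₀ ⊆ Ω := fun x hx => by
    by_contra hn
    have h0 := hu0.eq_zero x (by rw [hΩ.frontier_eq]; exact ⟨hx.1, hn⟩)
    have h1 : ε ≤ u x := hx.2
    linarith
  -- `K₀` lies in the interior of `K`, so u < ε at every point of `K` outside that interior.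
  obtain ⟨K, hK, hK₀K, hKΩ⟩ := exists_compact_between hK₀ hΩ hK₀Ω
  have hr : volume.restrict K ≤ volume.restrict Ω := Measure.restrict_mono hKΩ le_rfl
  have hΩfin : volume Ω ≠ ⊤ := hΩb.measure_lt_top.ne
  -- choose the approximation parameter
  set V : ℝ≥0∞ := volume K ^ (N : ℝ≥0∞).toReal⁻¹
  have hV : V ≠ ⊤ := ENNReal.rpow_ne_top_of_nonneg (by positivity) hK.measure_lt_top.ne
  set T : ℝ≥0∞ := (N * (N * ENNReal.ofReal Lam) + N * ENNReal.ofReal c₁) + ENNReal.ofReal c₂ * V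
    with hT
  have hTfin : T ≠ ⊤ := by
    rw [hT]
    finiteness
  have hgap : ENNReal.ofReal (μ - (eLpNorm f N (volume.restrict Ω)).toReal) ≠ 0 :=
    (ENNReal.ofReal_pos.mpr (sub_pos.mpr hμ)).ne'
  obtain ⟨η₀, hη₀, hη₀T⟩ := ENNReal.exists_nnreal_pos_mul_lt hTfin hgap
  -- `η₀` fits the total L^N error into the gap between `μ` and the norm of f; `ε` controls the
  -- uniform error.
  set η : ℝ := min η₀ ε
  have hη : 0 < η := lt_min (by exact_mod_cast hη₀) hε
  have hηT : ENNReal.ofReal η * T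
      ≤ ENNReal.ofReal (μ - (eLpNorm f N (volume.restrict Ω)).toReal) := by
    refine le_trans ?_ hη₀T.le
    gcongr
    rw [← ENNReal.ofReal_coe_nnreal]
    exact ENNReal.ofReal_le_ofReal (min_le_left _ _)
  obtain ⟨w, hw, hwu, hwg, hwh⟩ := exists_contDiff_approx hΩ hK hKΩ hp hp' hu
    (hu0.continuousOn.mono subset_closure) hη
  have hwuε : ∀ x ∈ K, |w x - u x| ≤ ε := fun x hx => (hwu x hx).trans (min_le_right _ _)
  set A : Fin N → Fin N → EuclideanSpace ℝ (Fin N) → ℝ :=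
    fun i j x => Lam * |hess w x i j - D2u i j x| with hA
  set B : Fin N → EuclideanSpace ℝ (Fin N) → ℝ := fun i x => c₁ * |grad w x i - Du i x| with hB
  set D : EuclideanSpace ℝ (Fin N) → ℝ := fun x => c₂ * |w x - u x| with hD
  set h : EuclideanSpace ℝ (Fin N) → ℝ :=
    (fun x => |f x|) + (((∑ i, ∑ j, A i j) + ∑ i, B i) + D) with hhdef
  have hhx : ∀ x, h x = |f x| + ((∑ i, ∑ j, Lam * |hess w x i j - D2u i j x|)
      + (∑ i, c₁ * |grad w x i - Du i x|) + c₂ * |w x - u x|) := fun x => by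
    simp [hhdef, hA, hB, hD, Finset.sum_apply]
  have hh0 : ∀ x, 0 ≤ h x := fun x => by rw [hhx]; positivity
  have hhnorm : eLpNorm h N (volume.restrict K) ≤ ENNReal.ofReal μ := by
    have hgc : ∀ i, Continuous fun x => grad w x i := fun i =>
      (contDiff_euclidean.mp (contDiff_grad hw) i).continuous
    have hhc : ∀ i j, Continuous fun x => hess w x i j := fun i j => by
      simp only [hess_apply hw]
      have : Continuous (fderiv ℝ (fderiv ℝ w)) :=
        (hw.fderiv_right (m := 1) (by norm_num)).continuous_fderiv (by norm_num)
      fun_prop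
    have hum : AEStronglyMeasurable u (volume.restrict K) := (hu.memLp K hK hKΩ).1
    have herr := eLpNorm_error_le (ν := volume.restrict K) hp (f := fun x => |f x|)
      (A := A) (B := B) (D := D) (η := ENNReal.ofReal η)
      (hf.1.mono_measure hr).norm
      (fun i j => ((hhc i j).aestronglyMeasurable.sub (hu.memLp_hess i j K hK hKΩ).1).norm.const_mul
        Lam)
      (fun i => ((hgc i).aestronglyMeasurable.sub (hu.memLp_grad i K hK hKΩ).1).norm.const_mul c₁)
      ((hw.continuous.aestronglyMeasurable.sub hum).norm.const_mul c₂)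
      (fun i j => eLpNorm_mul_abs_le hLam.le (hwh i j))
      (fun i => eLpNorm_mul_abs_le hc₁.le (hwg i))
      (γ₀ := ENNReal.ofReal c₂ * V) (by
        rw [mul_assoc]
        refine eLpNorm_mul_abs_le hc₂.le ?_
        refine (eLpNorm_le_of_ae_bound (C := η) ?_).trans ?_
        · filter_upwards [ae_restrict_mem hK.measurableSet] with x hx using hwu x hx
        · rw [Measure.restrict_apply_univ])
    refine herr.trans ?_
    have hfK : eLpNorm (fun x => |f x|) N (volume.restrict K)
        ≤ ENNReal.ofReal (eLpNorm f N (volume.restrict Ω)).toReal := by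
      rw [ENNReal.ofReal_toReal hf.2.ne]
      exact (eLpNorm_norm f).le.trans (eLpNorm_mono_measure f hr)
    refine (add_le_add hfK hηT).trans (le_of_eq ?_)
    rw [← ENNReal.ofReal_add ENNReal.toReal_nonneg (sub_nonneg.mpr hμ.le), add_sub_cancel]
  have hsymm : ∀ᵐ x ∂(volume.restrict Ω), ∀ i j, D2u i j x = D2u j i x :=
    ae_all_iff.mpr fun i => ae_all_iff.mpr fun j =>
      weak_hess_symm hΩ hu.weak_grad hu.weak_hess i j
  have hlow : ∀ᵐ x ∂(volume.restrict K), ∀ ξ : EuclideanSpace ℝ (Fin N),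
      lam * ‖ξ‖ ^ 2 ≤ ∑ i, ∑ j, (a i j x + a j i x) / 2 * ξ i * ξ j := by
    filter_upwards [ae_mono hr hco.lower] with x hx ξ
    refine (hx ξ).trans (le_of_eq ?_)
    simpa only [mul_assoc] using (sum_symmetrize_mul (fun i j => a i j x) (fun i j => ξ i * ξ j)
      fun i j => mul_comm _ _).symm
  -- Off the interior of `K`, w ≤ u + ε < 2ε, so w - 2ε is admissible; where it is positive, w ≥ 0
  -- as the sign of c requires. The shift and the uniform error make up the final 3ε.
  have hest := le_of_contDiff (w := fun x => w x - 2 * ε) (hw.sub contDiff_const) hK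
    (fun x hxK hxi => by
      have hux : u x < ε := by
        by_contra! hn
        exact hxi (hK₀K ⟨subset_closure (hKΩ hxK), hn⟩)
      linarith [le_abs_self (w x - u x), hwuε x hxK])
    hd (fun x hx y hy => Metric.dist_le_diam_of_mem hΩb (hKΩ hx) (hKΩ hy)) hlam
    (β := c₁ * N) (by positivity) hμ0 (a := fun i j x => (a i j x + a j i x) / 2) hlow hh0
    (by
      filter_upwards [ae_mono hr hco.lower, ae_mono hr hco.upper, ae_mono hr hco.bound_b,
        ae_mono hr hco.bound_c, ae_mono hr hco.nonpos_c, ae_mono hr hLu, ae_mono hr hsymm]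
        with x h1 h2 h3 h4 h5 h6 h7 hwx
      rw [grad_sub_const, hess_sub_const, hhx]
      refine neg_le_sum_hess (abs_symmetrize_le (fun ξ => le_trans (by positivity) (h1 ξ)) h2 hLam.le)
        h3 h4 h5 (by linarith) ?_
      rw [sum_symmetrize_mul (fun i j => a i j x) (fun i j => D2u i j x) h7]
      exact h6)
    (lintegral_ofReal_pow_le hN.ne' hh0 hhnorm)
    (interior_subset (hK₀K ⟨subset_closure hx₀, hge⟩))
  have hvol : volume.real K ≤ volume.real Ω := measureReal_mono hKΩ hΩfin
  have hfin : Metric.diam Ω * μ * Real.exp (4 ^ N / (N *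
      volume.real (Metric.ball (0 : EuclideanSpace ℝ (Fin N)) 1))
        * (lam⁻¹ ^ N * (1 + (c₁ * N) ^ N * volume.real K))) ≤ Metric.diam Ω * μ * Real.exp (4 ^ N
      / (N * volume.real (Metric.ball (0 : EuclideanSpace ℝ (Fin N)) 1))
        * (lam⁻¹ ^ N * (1 + (c₁ * N) ^ N * volume.real Ω))) := by gcongr
  have hxK := hwuε x₀ (interior_subset (hK₀K ⟨subset_closure hx₀, hge⟩))
  linarith [neg_abs_le (w x₀ - u x₀)]

/-- The term with c₁ has degree 2N in M; the term without it is raised to that degree using M ≥ 1.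
-/
theorem exponent_le {N : ℕ} (hN : 0 < N) {k l c₁ V M : ℝ} (hk : 0 ≤ k) (hl : 0 ≤ l) (hc₁ : 0 ≤ c₁)
    (hV : 0 ≤ V) (hlM : l ≤ M) (hcM : c₁ ≤ M) (hM : 1 ≤ M) :
    k * (l ^ N * (1 + (c₁ * N) ^ N * V)) ≤ k * N ^ N * (1 + V) * M ^ (2 * N) := by
  have hN1 : (1 : ℝ) ≤ (N : ℝ) ^ N := one_le_pow₀ (by exact_mod_cast hN)
  have hMN : 1 ≤ M ^ N := one_le_pow₀ hM
  calc k * (l ^ N * (1 + (c₁ * N) ^ N * V))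
      ≤ k * (M ^ N * (M ^ N * N ^ N * 1 + (M * N) ^ N * V)) := by
        gcongr
        nlinarith
    _ = _ := by ring

end ABP

/-! ### The main theorem. -/

theorem theoremC1 (n : ℕ) :
    ∃ (C : ℝ) (m : ℕ), 0 < C ∧
      ∀ (Ω : Set (EuclideanSpace ℝ (Fin (n + 1)))),
        IsOpen Ω → Bornology.IsBounded Ω →
      ∀ (lam Lam c₁ c₂ : ℝ), 0 < lam → 0 < Lam → 0 < c₁ → 0 < c₂ →
      ∀ (a : Fin (n + 1) → Fin (n + 1) → EuclideanSpace ℝ (Fin (n + 1)) → ℝ)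
        (b : Fin (n + 1) → EuclideanSpace ℝ (Fin (n + 1)) → ℝ)
        (c : EuclideanSpace ℝ (Fin (n + 1)) → ℝ),
        ABP.CoeffBounds Ω a b c lam Lam c₁ c₂ →
      ∀ (f : EuclideanSpace ℝ (Fin (n + 1)) → ℝ),
        MemLp f ((n + 1 : ℕ) : ℝ≥0∞) (volume.restrict Ω) →
      ∀ (u : EuclideanSpace ℝ (Fin (n + 1)) → ℝ)
        (Du : Fin (n + 1) → EuclideanSpace ℝ (Fin (n + 1)) → ℝ)
        (D2u : Fin (n + 1) → Fin (n + 1) → EuclideanSpace ℝ (Fin (n + 1)) → ℝ),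
        ABP.IsC00 Ω u →
        ABP.IsW2Loc ((n + 1 : ℕ) : ℝ≥0∞) Ω u Du D2u →
        (∀ᵐ x ∂(volume.restrict Ω), f x ≤ ABP.ellipticOp a b c u Du D2u x) →
      ∀ x ∈ Ω,
        u x ≤ Real.exp (C * (1 + (volume Ω).toReal) * ABP.coeffSize lam Lam c₁ c₂ ^ m)
          * Metric.diam Ω
          * (eLpNorm f ((n + 1 : ℕ) : ℝ≥0∞) (volume.restrict Ω)).toReal := by
  have hvB : 0 < volume.real (Metric.ball (0 : EuclideanSpace ℝ (Fin (n + 1))) 1) :=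
    ENNReal.toReal_pos (Metric.measure_ball_pos _ _ one_pos).ne' measure_ball_lt_top.ne
  set k : ℝ := 4 ^ (n + 1) / ((n + 1 : ℕ) *
    volume.real (Metric.ball (0 : EuclideanSpace ℝ (Fin (n + 1))) 1)) with hk
  have hk0 : 0 < k := by positivity
  refine ⟨k * (n + 1 : ℕ) ^ (n + 1), 2 * (n + 1), by positivity, ?_⟩
  intro Ω hΩ hΩb lam Lam c₁ c₂ hlam hLam hc₁ hc₂ a b c hco f hf u Du D2u hu0 hu hLu x hx
  set F := (eLpNorm f ((n + 1 : ℕ) : ℝ≥0∞) (volume.restrict Ω)).toReal with hF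
  obtain ⟨h1, h2, h3⟩ := ABP.le_coeffSize (Lam := Lam) (c₁ := c₁) (c₂ := c₂) hlam
  have hexp := Real.exp_le_exp.mpr (ABP.exponent_le n.succ_pos hk0.le (inv_pos.mpr hlam).le hc₁.le
    (measureReal_nonneg (μ := volume) (s := Ω)) h1 h2 h3)
  set X := Real.exp (k * (lam⁻¹ ^ (n + 1) * (1 + (c₁ * (n + 1 : ℕ)) ^ (n + 1) * volume.real Ω)))
  have hd : 0 ≤ Metric.diam Ω := Metric.diam_nonneg
  have hF0 : 0 ≤ F := ENNReal.toReal_nonneg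
  have hmain : u x ≤ X * Metric.diam Ω * F := by
    -- Half of `τ` pays for 3ε with ε = τ/6, half for the excess of `μ` over `F`, which must be
    -- strict. The summand 1 in `s` keeps the divisor positive.
    refine le_of_forall_pos_le_add fun τ hτ => ?_
    set s := X * Metric.diam Ω + 1 with hs
    have hs0 : 0 < s := by positivity
    have h := ABP.le_add_of_lt hΩ hΩb hlam hLam hc₁ hc₂ hco hf hu0 hu hLu
      (ε := τ / 6) (μ := F + τ / 2 / s) (by positivity)
      (by rw [← hF]; exact lt_add_of_pos_right _ (by positivity)) hx
    have h5 : X * Metric.diam Ω * (τ / 2 / s) ≤ τ / 2 := by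
      calc X * Metric.diam Ω * (τ / 2 / s) ≤ s * (τ / 2 / s) := by
            gcongr
            linarith
        _ = τ / 2 := mul_div_cancel₀ _ hs0.ne'
    have h6 : u x ≤ 3 * (τ / 6) + Metric.diam Ω * (F + τ / 2 / s) * X := h
    linarith
  refine hmain.trans ?_
  gcongr
  exact hexp
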